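/- Let $S_0$ be a finite non-empty set, let $A_{i,j}$, $i,j\in\mathbb{H}=\{-1,0,1\}$, be nonnegative real $S_0\times S_0$ matrices such that $\sum_{i,j\in\mathbb{H}}A_{i,j}$ is stochastic, and assume that the Markov chain on $\mathbb{Z}^2\times S_0$ which moves from $(x_1,x_2,j)$ to $(x_1+k,x_2+l,j')$, $k,l\in\mathbb{H}$, with probability $[A_{k,l}]_{j,j'}$ is irreducible and aperiodic. For nonzero complex $z,w$ put $$A_{*,j}(z)=\sum_{i\in\mathbb{H}}A_{i,j}z^i\quad(j\in\mathbb{H}),\qquad C(z,w)=\sum_{i,j\in\mathbb{H}}A_{i,j}z^iw^j,$$ and let $\underline{z}_1^*=e^{\min s_1}$ and $\bar z_1^*=e^{\max s_1}$, the extrema being taken over the set of all $(s_1,s_2)\in\mathbb{R}^2$ for which the spectral radius of $C(e^{s_1},e^{s_2})$ is at most $1$. For $n\ge 1$ let $\mathscr{I}_n$ (respectively $\mathscr{I}_{D,n}$) be the set of all $(i_1,\dots,i_n)\in\mathbb{H}^n$ with $i_1+\dots+i_k\ge 0$ for $1\le k\le n-1$ and $i_1+\dots+i_n=0$ (respectively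 $=-1$), and let $\mathscr{I}_{U,n}$ be the set of those with $i_1+\dots+i_k\ge 1$ for $1\le k\le n-1$ and $i_1+\dots+i_n=1$. Let $Q^{(n)}(z)$, $D^{(n)}(z)$, $U^{(n)}(z)$ be the sums of $A_{*,i_1}(z)A_{*,i_2}(z)\cdots A_{*,i_n}(z)$ over $\mathscr{I}_n$, $\mathscr{I}_{D,n}$, $\mathscr{I}_{U,n}$ respectively, let $Q^{(0)}(z)=I$, and define $$N_1(z)=\sum_{n=0}^\infty Q^{(n)}(z),\qquad G_1(z)=\sum_{n=1}^\infty D^{(n)}(z),\qquad R_1(z)=\sum_{n=1}^\infty U^{(n)}(z).$$ Then the following hold for every complex $z$ with $\underline{z}_1^*\le|z|\le\bar z_1^*$, where the modulus of a matrix and inequalities between matrices are entrywise. (i) The three series converge absolutely, and $|N_1(z)|\le N_1(|z|)$, $|G_1(z)|\le G_1(|z|)$, $|R_1(z)|\le R_1(|z|)$. (ii) $G_1(z)=N_1(z)A_{*,-1}(z)$ and $R_1(z)=A_{*,1}(z)N_1(z)$. (iii) $A_{*,-1}(z)+A_{*,0}(z)G_1(z)+A_{*,1}(z)G_1(z)^2=G_1(z)$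 and $R_1(z)^2A_{*,-1}(z)+R_1(z)A_{*,0}(z)+A_{*,1}(z)=R_1(z)$. (iv) With $H_1(z)=A_{*,0}(z)+A_{*,1}(z)N_1(z)A_{*,-1}(z)$, we have $(I-H_1(z))N_1(z)=I$. (v) For every nonzero $w\in\mathbb{C}$, $I-C(z,w)=\bigl(w^{-1}I-R_1(z)\bigr)\bigl(I-H_1(z)\bigr)\bigl(wI-G_1(z)\bigr)$. -/

import Mathlib

noncomputable section

namespace TwoDQBD

/-- The set `{-1, 0, 1}` of one-step displacements of a skip-free walk. -/
def ℍ : Finset ℤ := {-1, 0, 1}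

/-- `i₁ + ⋯ + i_k` for a sequence `(i₁, …, i_n)` and `k ≤ n` (the entry `i_l` is `i (l - 1)` here). -/
def partialSum {n : ℕ} (i : Fin n → ℤ) (k : ℕ) : ℤ :=
  ∑ l : Fin n with l.val < k, i l

/-- All sequences in `{-1, 0, 1}^n`. -/
def seqAll (n : ℕ) : Finset (Fin n → ℤ) :=
  Fintype.piFinset fun _ => ℍ

/-- Sequences in `{-1, 0, 1}^n` whose partial sums `i₁ + ⋯ + i_k`, `1 ≤ k ≤ n - 1`, are all `≥ 0`,
and whose total is `0`. -/
def seqN (n : ℕ) : Finset (Fin n → ℤ) :=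
  {i ∈ seqAll n |
    (∀ k < n, 1 ≤ k → 0 ≤ partialSum i k) ∧ ∑ l, i l = 0}

/-- Sequences in `{-1, 0, 1}^n` whose partial sums `i₁ + ⋯ + i_k`, `1 ≤ k ≤ n - 1`, are all `≥ 0`,
and whose total is `-1`: the sequences that first reach level `-1` at step `n`. -/
def seqD (n : ℕ) : Finset (Fin n → ℤ) :=
  {i ∈ seqAll n |
    (∀ k < n, 1 ≤ k → 0 ≤ partialSum i k) ∧ ∑ l, i l = -1}

/-- Sequences in `{-1, 0, 1}^n` whose partial sums `i₁ + ⋯ + i_k`, `1 ≤ k ≤ n - 1`, are all `≥ 1`,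
and whose total is `1`. -/
def seqU (n : ℕ) : Finset (Fin n → ℤ) :=
  {i ∈ seqAll n |
    (∀ k < n, 1 ≤ k → 1 ≤ partialSum i k) ∧ ∑ l, i l = 1}

variable {S : Type*} [Fintype S] [DecidableEq S]

/-- The matrix `A_{*,*}`, the sum of the blocks `A_{i,j}` over `i, j ∈ {-1, 0, 1}`. The value of `A i j`
for other `i, j` is never used. -/
def blockSum (A : ℤ → ℤ → Matrix S S ℝ) : Matrix S S ℝ :=
  ∑ i ∈ ℍ, ∑ j ∈ ℍ, A i j

/-- The transition matrix, on the state space `ℤ² × S`, of the space-homogeneous skip-free Markov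
chain generated by the blocks `A_{i,j}`: a transition from `(x₁, x₂, j)` to `(x₁', x₂', j')` has
probability `[A_{x₁' - x₁, x₂' - x₂}]_{j j'}` if both displacements lie in `{-1, 0, 1}`, and
probability `0` otherwise. -/
def transitionMatrix (A : ℤ → ℤ → Matrix S S ℝ) : Matrix (ℤ × ℤ × S) (ℤ × ℤ × S) ℝ :=
  Matrix.of fun x y =>
    if y.1 - x.1 ∈ ℍ ∧ y.2.1 - x.2.1 ∈ ℍ then A (y.1 - x.1) (y.2.1 - x.2.1) x.2.2 y.2.2 else 0

/-- The `n`-step transition probabilities of a Markov chain with transition matrix `P`. -/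
def nStep {X : Type*} [DecidableEq X] (P : Matrix X X ℝ) : ℕ → X → X → ℝ
  | 0, x, y => if x = y then 1 else 0
  | n + 1, x, y => ∑' u, P x u * nStep P n u y

/-- Aperiodicity of a Markov chain: for every state `x` the greatest common divisor of the lengths
`n` of its possible returns is `1`. -/
def IsAperiodic {X : Type*} [DecidableEq X] (P : Matrix X X ℝ) : Prop :=
  ∀ x : X, ∀ d : ℕ, (∀ n : ℕ, 1 ≤ n → 0 < nStep P n x x → d ∣ n) → d = 1

/-- `A_{*,j}(z)`, the sum of `A_{i,j} z ^ i` over `i ∈ {-1, 0, 1}`. -/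
def Astar (A : ℤ → ℤ → Matrix S S ℝ) (j : ℤ) (z : ℂ) : Matrix S S ℂ :=
  ∑ i ∈ ℍ, z ^ i • (A i j).map (fun x : ℝ => (x : ℂ))

/-- `C(z, w)`, the sum of `A_{i,j} z ^ i w ^ j` over `i, j ∈ {-1, 0, 1}`. -/
def C (A : ℤ → ℤ → Matrix S S ℝ) (z w : ℂ) : Matrix S S ℂ :=
  ∑ i ∈ ℍ, ∑ j ∈ ℍ, (z ^ i * w ^ j) • (A i j).map (fun x : ℝ => (x : ℂ))

/-- `χ(z₁, z₂)`, the spectral radius of `C(z₁, z₂)`. -/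
def χ (A : ℤ → ℤ → Matrix S S ℝ) (z₁ z₂ : ℝ) : ENNReal :=
  spectralRadius ℂ (C A (z₁ : ℂ) (z₂ : ℂ))

/-- The set of the real `(s₁, s₂)` with `χ(exp s₁, exp s₂) ≤ 1`. -/
def Γbar (A : ℤ → ℤ → Matrix S S ℝ) : Set (ℝ × ℝ) :=
  {s | χ A (Real.exp s.1) (Real.exp s.2) ≤ 1}

/-- The lower extreme value: `exp` of the least first coordinate of a point of `Γbar`. -/
def zLow₁ (A : ℤ → ℤ → Matrix S S ℝ) : ℝ := Real.exp (sInf (Prod.fst '' Γbar A))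

/-- The upper extreme value: `exp` of the greatest first coordinate of a point of `Γbar`. -/
def zHigh₁ (A : ℤ → ℤ → Matrix S S ℝ) : ℝ := Real.exp (sSup (Prod.fst '' Γbar A))

/-- The product `A_{*,i₁}(z) A_{*,i₂}(z) ⋯ A_{*,i_n}(z)`, in this order. -/
def pathProd (A : ℤ → ℤ → Matrix S S ℝ) (z : ℂ) {n : ℕ} (i : Fin n → ℤ) : Matrix S S ℂ :=
  (List.ofFn fun l => Astar A (i l) z).prod

/-- `Q₁₁⁽ⁿ⁾(z)`, with `Q₁₁⁽⁰⁾(z) = I`. -/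
def Q₁₁ (A : ℤ → ℤ → Matrix S S ℝ) (z : ℂ) : ℕ → Matrix S S ℂ
  | 0 => 1
  | n + 1 => ∑ i ∈ seqN (n + 1), pathProd A z i

/-- `D₁⁽ⁿ⁾(z)`, used for `n ≥ 1`. -/
def D₁ (A : ℤ → ℤ → Matrix S S ℝ) (z : ℂ) (n : ℕ) : Matrix S S ℂ :=
  ∑ i ∈ seqD n, pathProd A z i

/-- `U₁⁽ⁿ⁾(z)`, used for `n ≥ 1`. -/
def U₁ (A : ℤ → ℤ → Matrix S S ℝ) (z : ℂ) (n : ℕ) : Matrix S S ℂ :=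
  ∑ i ∈ seqU n, pathProd A z i

/-- `N₁(z)`, the sum of `Q₁₁⁽ⁿ⁾(z)` over `n ≥ 0`. -/
def N₁ (A : ℤ → ℤ → Matrix S S ℝ) (z : ℂ) : Matrix S S ℂ := ∑' n : ℕ, Q₁₁ A z n

/-- `G₁(z)`, the sum of `D₁⁽ⁿ⁾(z)` over `n ≥ 1`. -/
def G₁ (A : ℤ → ℤ → Matrix S S ℝ) (z : ℂ) : Matrix S S ℂ := ∑' n : ℕ, D₁ A z (n + 1)

/-- `R₁(z)`, the sum of `U₁⁽ⁿ⁾(z)` over `n ≥ 1`. -/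
def R₁ (A : ℤ → ℤ → Matrix S S ℝ) (z : ℂ) : Matrix S S ℂ := ∑' n : ℕ, U₁ A z (n + 1)

/-- `H₁(z) = A_{*,0}(z) + A_{*,1}(z) N₁(z) A_{*,-1}(z)`. -/
def H₁ (A : ℤ → ℤ → Matrix S S ℝ) (z : ℂ) : Matrix S S ℂ :=
  Astar A 0 z + Astar A 1 z * N₁ A z * Astar A (-1) z

end TwoDQBD

end

open TwoDQBD

open scoped ComplexOrder

/-! Everything follows from the entrywise convergence of N₁(x) at x = |z|: paths weighted by
A_{*,j}(z) are dominated by the same paths at x, and the rest is algebra.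

For convergence, look for w > 0 and a positive vector h with C(x,w)h ≤ h. In the coordinates x = exp
s₁, w = exp s₂, h = exp u, the pairs (s,u) with C h ≤ τ h form a closed convex set, compact by
irreducibility once u is fixed at one state. A truncated Neumann series puts every point of `Γbar`
in this set for each τ > 1, and compactness brings τ down to 1 (`exists_subinvariant_of_mem_Γbar`).
The projection to s₁ is therefore a compact interval containing that of `Γbar`, hence containing log
x (`exists_subinvariant_of_mem_Icc`).

Subinvariance bounds the partial sums of ∑ Q⁽ⁿ⁾A_{*,-1}h by w h (`sum_excursion_mulVec_le`). Since
A_{*,-1}h may have zero entries, irreducibility is used again to bound the single entries of Q⁽ⁿ⁾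
(`summable_excursion`).

Cutting paths at their last or first step gives D⁽ⁿ⁺¹⁾ = Q⁽ⁿ⁾A_{*,-1} and U⁽ⁿ⁺¹⁾ = A_{*,1}Q⁽ⁿ⁾, and
first passages give N₁ = I + H₁N₁ (`N₁_first_return`). So N₁ is the inverse of I − H₁, from which
the equations and the factorization follow. -/

namespace TwoDQBD

open Finset Filter Topology

/-! ### Path sums as a first-step recursion, over an arbitrary semiring. -/

section Excursions

variable {M : Type*} [Semiring M]

/-- The total weight of the skip-free walks of `n` steps that lead from level `a` to level `0` without
becoming negative, a step `j` carrying the weight `B j` and weights being multiplied in order. -/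
def excursion (B : ℤ → M) : ℕ → ℕ → M
  | 0, a => if a = 0 then 1 else 0
  | n + 1, 0 => B 0 * excursion B n 0 + B 1 * excursion B n 1
  | n + 1, a + 1 => B (-1) * excursion B n a + B 0 * excursion B n (a + 1) +
      B 1 * excursion B n (a + 2)

/-- The walk started at level `a` stays nonnegative and ends at level `0`. -/
def IsExcursion {n : ℕ} (a : ℤ) (i : Fin n → ℤ) : Prop :=
  (∀ k ≤ n, 0 ≤ a + partialSum i k) ∧ a + ∑ l, i l = 0

lemma sum_displacements (f : ℤ → M) : ∑ j ∈ ℍ, f j = f (-1) + f 0 + f 1 := by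
  have h1 : (-1 : ℤ) ∉ ({0, 1} : Finset ℤ) := by decide
  have h2 : (0 : ℤ) ∉ ({1} : Finset ℤ) := by decide
  rw [ℍ, sum_insert h1, sum_insert h2, sum_singleton, add_assoc]

lemma partialSum_zero {n : ℕ} (i : Fin n → ℤ) : partialSum i 0 = 0 := by
  simp [partialSum]

lemma partialSum_self {n : ℕ} (i : Fin n → ℤ) : partialSum i n = ∑ l, i l := by
  simp [partialSum]

lemma partialSum_cons {n : ℕ} (j : ℤ) (i : Fin n → ℤ) (k : ℕ) :
    partialSum (Fin.cons j i : Fin (n + 1) → ℤ) (k + 1) = j + partialSum i k := by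
  simp [partialSum, sum_filter, Fin.sum_univ_succ]

lemma partialSum_snoc {n : ℕ} (i : Fin n → ℤ) (j : ℤ) {k : ℕ} (hk : k ≤ n) :
    partialSum (Fin.snoc i j : Fin (n + 1) → ℤ) k = partialSum i k := by
  simp [partialSum, sum_filter, Fin.sum_univ_castSucc, hk]

lemma sum_seqAll_cons (n : ℕ) (F : (Fin (n + 1) → ℤ) → M) :
    ∑ i ∈ seqAll (n + 1), F i = ∑ j ∈ ℍ, ∑ i ∈ seqAll n, F (Fin.cons j i) := by
  rw [← sum_product']
  refine sum_nbij' (fun i => (i 0, Fin.tail i)) (fun p => Fin.cons p.1 p.2) ?_ ?_ ?_ ?_ ?_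
  · intro i hi
    simp only [seqAll, Fintype.mem_piFinset, mem_product] at hi ⊢
    exact ⟨hi 0, fun l => hi l.succ⟩
  · intro p hp
    simp only [seqAll, Fintype.mem_piFinset, mem_product] at hp ⊢
    exact Fin.cases hp.1 hp.2
  · intro i _
    exact Fin.cons_self_tail i
  · intro p _
    simp
  · intro i _
    simp

lemma sum_seqAll_snoc (n : ℕ) (F : (Fin (n + 1) → ℤ) → M) :
    ∑ i ∈ seqAll (n + 1), F i = ∑ j ∈ ℍ, ∑ i ∈ seqAll n, F (Fin.snoc i j) := by
  rw [← sum_product']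
  refine sum_nbij' (fun i => (i (Fin.last n), Fin.init i)) (fun p => Fin.snoc p.2 p.1) ?_ ?_ ?_ ?_ ?_
  · intro i hi
    simp only [seqAll, Fintype.mem_piFinset, mem_product] at hi ⊢
    exact ⟨hi _, fun l => hi l.castSucc⟩
  · intro p hp
    simp only [seqAll, Fintype.mem_piFinset, mem_product] at hp ⊢
    refine Fin.lastCases ?_ fun l => ?_
    · simpa using hp.1
    · simpa using hp.2 l
  · intro i _
    exact Fin.snoc_init_self i
  · intro p _
    simp
  · intro i _
    simp

lemma isExcursion_cons {n : ℕ} (a j : ℤ) (i : Fin n → ℤ) :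
    IsExcursion a (Fin.cons j i : Fin (n + 1) → ℤ) ↔ 0 ≤ a ∧ IsExcursion (a + j) i := by
  have h1 : (∀ k ≤ n + 1, 0 ≤ a + partialSum (Fin.cons j i : Fin (n + 1) → ℤ) k) ↔
      0 ≤ a ∧ ∀ k ≤ n, 0 ≤ a + j + partialSum i k := by
    constructor
    · intro h
      refine ⟨by simpa [partialSum_zero] using h 0 (by lia), fun k hk => ?_⟩
      have := h (k + 1) (by lia)
      rw [partialSum_cons] at this
      lia
    · rintro ⟨h0, h⟩ k hk
      cases k with
      | zero => simpa [partialSum_zero] using h0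
      | succ k =>
        rw [partialSum_cons]
        have := h k (by lia)
        lia
  rw [IsExcursion, h1, IsExcursion, and_assoc]
  simp [Fin.sum_univ_succ, add_assoc]

open Classical in
lemma sum_isExcursion_of_neg (B : ℤ → M) (n : ℕ) {a : ℤ} (ha : a < 0) :
    ∑ i ∈ seqAll n, (if IsExcursion a i then (List.ofFn fun l => B (i l)).prod else 0) = 0 := by
  refine sum_eq_zero fun i _ => if_neg fun h => ?_
  have := h.1 0 (by lia)
  rw [partialSum_zero] at this
  lia

open Classical in
lemma sum_isExcursion (B : ℤ → M) (n a : ℕ) :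
    ∑ i ∈ seqAll n, (if IsExcursion (a : ℤ) i then (List.ofFn fun l => B (i l)).prod else 0) =
      excursion B n a := by
  induction n generalizing a with
  | zero =>
    have h : seqAll 0 = {Fin.elim0} := by
      ext i
      simp only [seqAll, Fintype.mem_piFinset, mem_singleton]
      exact ⟨fun _ => Subsingleton.elim _ _, fun _ l => l.elim0⟩
    simp [h, excursion, IsExcursion, partialSum_zero]
  | succ n ih =>
    have key : ∀ j : ℤ, ∑ i ∈ seqAll n, (if IsExcursion (a : ℤ) (Fin.cons j i : Fin (n + 1) → ℤ)
        then (List.ofFn fun l => B ((Fin.cons j i : Fin (n + 1) → ℤ) l)).prod else 0) =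
        B j * ∑ i ∈ seqAll n,
          (if IsExcursion ((a : ℤ) + j) i then (List.ofFn fun l => B (i l)).prod else 0) := by
      intro j
      rw [mul_sum]
      refine sum_congr rfl fun i _ => ?_
      simp [isExcursion_cons, List.ofFn_succ, mul_ite]
    rw [sum_seqAll_cons, sum_displacements, key, key, key]
    have e0 := ih a
    have e1 := ih (a + 1)
    rw [add_zero, e0]
    push_cast at e1
    rw [e1]
    cases a with
    | zero => rw [sum_isExcursion_of_neg B n (by simp)]; simp [excursion]
    | succ a =>
      have e2 := ih a
      rw [show ((a + 1 : ℕ) : ℤ) + -1 = a by push_cast; ring, e2]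
      simp [excursion]

lemma excursion_succ_zero (B : ℤ → M) (n : ℕ) :
    excursion B (n + 1) 0 = B 0 * excursion B n 0 + B 1 * excursion B n 1 := rfl

lemma excursion_succ_succ (B : ℤ → M) (n a : ℕ) :
    excursion B (n + 1) (a + 1) = B (-1) * excursion B n a + B 0 * excursion B n (a + 1) +
      B 1 * excursion B n (a + 2) := rfl

/-- Decomposition of a walk from level `a + 1` at its first passage to level `a`. -/
lemma excursion_succ_level (B : ℤ → M) (n a : ℕ) :
    excursion B (n + 1) (a + 1) =
      ∑ p ∈ antidiagonal n, excursion B p.1 a * B (-1) * excursion B p.2 0 := by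
  -- In each summand the factor `excursion B p.1 a` is the part of the walk before its first visit
  -- to level 0, lowered by one level; the induction peels off the first step.
  induction n generalizing a with
  | zero =>
    rcases a with _ | a <;> simp [excursion]
  | succ n ih =>
    rw [Nat.sum_antidiagonal_succ, excursion_succ_succ B (n + 1), ih a, ih (a + 1)]
    cases a with
    | zero =>
      simp only [excursion_succ_zero, add_mul, mul_assoc, sum_add_distrib, ← mul_sum]
      simp [excursion, add_assoc]
    | succ a =>
      rw [ih a]
      simp only [excursion_succ_succ, add_mul, mul_assoc, sum_add_distrib, mul_sum]
      simp [excursion]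

end Excursions

lemma mem_displacements {j : ℤ} : j ∈ ℍ ↔ j = -1 ∨ j = 0 ∨ j = 1 := by
  simp [ℍ]

lemma seqN_condition {n : ℕ} (i : Fin n → ℤ) :
    ((∀ k < n, 1 ≤ k → 0 ≤ partialSum i k) ∧ ∑ l, i l = 0) ↔ IsExcursion 0 i := by
  simp only [IsExcursion, zero_add]
  refine and_congr_left fun h => ⟨fun H k hk => ?_, fun H k hk _ => H k hk.le⟩
  rcases Nat.eq_zero_or_pos k with rfl | h0
  · rw [partialSum_zero]
  rcases hk.lt_or_eq with h1 | rfl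
  · exact H k h1 h0
  · rw [partialSum_self, h]

/-- Before the last step the walk is at level ≥ 0, so a skip-free step reaching −1 must be −1 and
start from 0. -/
lemma seqD_condition {n : ℕ} (i : Fin n → ℤ) {j : ℤ} (hj : j ∈ ℍ) :
    ((∀ k < n + 1, 1 ≤ k → 0 ≤ partialSum (Fin.snoc i j : Fin (n + 1) → ℤ) k) ∧
      ∑ l, (Fin.snoc i j : Fin (n + 1) → ℤ) l = -1) ↔ j = -1 ∧ IsExcursion 0 i := by
  rw [← seqN_condition, Fin.sum_univ_castSucc]
  simp only [Fin.snoc_castSucc, Fin.snoc_last]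
  rw [mem_displacements] at hj
  constructor
  · rintro ⟨h, ht⟩
    have h' : ∀ k < n + 1, 1 ≤ k → 0 ≤ partialSum i k := fun k hk h1 => by
      simpa [partialSum_snoc i j (Nat.lt_succ_iff.1 hk)] using h k hk h1
    have hs : 0 ≤ ∑ l, i l := by
      rcases Nat.eq_zero_or_pos n with rfl | hn
      · simp
      · simpa [partialSum_self] using h' n (by lia) hn
    exact ⟨by lia, fun k hk => h' k (by lia), by lia⟩
  · rintro ⟨rfl, h, ht⟩
    refine ⟨fun k hk h1 => ?_, by lia⟩
    rw [partialSum_snoc i _ (by lia)]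
    rcases (Nat.lt_succ_iff.1 hk).lt_or_eq with h2 | rfl
    · exact h k h2 h1
    · rw [partialSum_self, ht]

/-- The first step must go up; relative to level 1 the remaining walk is an excursion. -/
lemma seqU_condition {n : ℕ} (i : Fin n → ℤ) {j : ℤ} (hj : j ∈ ℍ) :
    ((∀ k < n + 1, 1 ≤ k → 1 ≤ partialSum (Fin.cons j i : Fin (n + 1) → ℤ) k) ∧
      ∑ l, (Fin.cons j i : Fin (n + 1) → ℤ) l = 1) ↔ j = 1 ∧ IsExcursion 0 i := by
  rw [← seqN_condition, Fin.sum_univ_succ]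
  simp only [Fin.cons_zero, Fin.cons_succ]
  rw [mem_displacements] at hj
  constructor
  · rintro ⟨h, ht⟩
    have h' : ∀ k < n, 1 ≤ j + partialSum i k := fun k hk => by
      rw [← partialSum_cons]
      exact h (k + 1) (by lia) (by lia)
    have hj1 : j = 1 := by
      rcases Nat.eq_zero_or_pos n with rfl | hn
      · simpa using ht
      · have := h' 0 hn
        rw [partialSum_zero] at this
        lia
    exact ⟨hj1, fun k hk _ => by linarith [h' k hk], by lia⟩
  · rintro ⟨rfl, h, ht⟩
    refine ⟨fun k hk h1 => ?_, by lia⟩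
    obtain ⟨k, rfl⟩ := Nat.exists_eq_add_of_le' h1
    rw [partialSum_cons]
    rcases Nat.eq_zero_or_pos k with rfl | h2
    · rw [partialSum_zero, add_zero]
    · linarith [h k (by lia) h2]

/-! ### The matrices Q, D, U in terms of excursions. -/

section PathSums

variable {S : Type*} [Fintype S] [DecidableEq S] (A : ℤ → ℤ → Matrix S S ℝ) (z : ℂ)

open Classical in
lemma sum_pathProd (n : ℕ) :
    ∑ i ∈ seqAll n, (if IsExcursion 0 i then pathProd A z i else 0) =
      excursion (fun j => Astar A j z) n 0 := by
  rw [← sum_isExcursion]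
  rfl

lemma Q₁₁_eq_excursion (n : ℕ) : Q₁₁ A z n = excursion (fun j => Astar A j z) n 0 := by
  classical
  cases n with
  | zero => simp [Q₁₁, excursion]
  | succ n =>
    rw [← sum_pathProd, Q₁₁, seqN, sum_filter]
    simp only [seqN_condition]

lemma D₁_succ (n : ℕ) : D₁ A z (n + 1) = Q₁₁ A z n * Astar A (-1) z := by
  classical
  rw [Q₁₁_eq_excursion, ← sum_pathProd, D₁, seqD, sum_filter, sum_seqAll_snoc,
    sum_eq_single (-1 : ℤ), sum_mul]
  · refine sum_congr rfl fun i _ => ?_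
    rw [if_congr (seqD_condition i (by decide)) rfl rfl]
    rw [ite_mul, zero_mul, pathProd, List.ofFn_succ']
    simp [pathProd]
  · intro j hj hne
    refine sum_eq_zero fun i _ => ?_
    rw [if_congr (seqD_condition i hj) rfl rfl, if_neg fun h => hne h.1]
  · exact fun h => absurd (by decide) h

lemma U₁_succ (n : ℕ) : U₁ A z (n + 1) = Astar A 1 z * Q₁₁ A z n := by
  classical
  rw [Q₁₁_eq_excursion, ← sum_pathProd, U₁, seqU, sum_filter, sum_seqAll_cons,
    sum_eq_single (1 : ℤ), mul_sum]
  · refine sum_congr rfl fun i _ => ?_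
    rw [if_congr (seqU_condition i (by decide)) rfl rfl]
    simp [pathProd, List.ofFn_succ, mul_ite]
  · intro j hj hne
    refine sum_eq_zero fun i _ => ?_
    rw [if_congr (seqU_condition i hj) rfl rfl, if_neg fun h => hne h.1]
  · exact fun h => absurd (by decide) h

end PathSums

/-! ### Subinvariant vectors: Gelfand's formula, compactness, convexity. -/

section Subinvariance

variable {S : Type*} {A : ℤ → ℤ → Matrix S S ℝ}

lemma reflTransGen_of_isIrreducible {X : Type*} {P : Matrix X X ℝ} (hP : P.IsIrreducible) (x y : X) :
    Relation.ReflTransGen (fun x y => 0 < P x y) x y := by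
  let := Matrix.toQuiver P
  obtain ⟨p, -⟩ := hP.connected x y
  induction p with
  | nil => exact .refl
  | cons _ e ih => exact ih.tail e.down

lemma transitionMatrix_pos {x y : ℤ × ℤ × S} (h : 0 < transitionMatrix A x y) :
    y.1 - x.1 ∈ ℍ ∧ y.2.1 - x.2.1 ∈ ℍ ∧ 0 < A (y.1 - x.1) (y.2.1 - x.2.1) x.2.2 y.2.2 := by
  rw [transitionMatrix, Matrix.of_apply] at h
  split_ifs at h with hc
  · exact ⟨hc.1, hc.2, h⟩
  · exact absurd h (lt_irrefl _)

variable [Fintype S]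

open scoped Matrix.Norms.Operator in
lemma exists_mulVec_le_of_spectralRadius_le_one [DecidableEq S] {M : Matrix S S ℝ} (hM : ∀ j l, 0 ≤ M j l)
    (hs : spectralRadius ℂ (M.map (fun x : ℝ => (x : ℂ))) ≤ 1) {τ : ℝ} (hτ : 1 < τ) :
    ∃ v : S → ℝ, (∀ j, 1 ≤ v j) ∧ ∀ j, (M.mulVec v) j ≤ τ * v j := by
  have hτ0 : 0 < τ := by linarith
  have hlt : spectralRadius ℂ (M.map (fun x : ℝ => (x : ℂ))) < ENNReal.ofReal τ :=
    hs.trans_lt (by simpa using hτ)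
  -- Gelfand's formula yields ‖M^N‖ ≤ τ^N; the norm in force is the maximal absolute row sum, so it
  -- controls M^N 1.
  obtain ⟨N, hN, hN1⟩ := ((spectrum.pow_norm_pow_one_div_tendsto_nhds_spectralRadius
    (M.map (fun x : ℝ => (x : ℂ)))).eventually_lt_const hlt |>.and (eventually_ge_atTop 1)).exists
  rw [ENNReal.ofReal_lt_ofReal_iff hτ0] at hN
  have hnorm : ‖(M.map (fun x : ℝ => (x : ℂ))) ^ N‖ ≤ τ ^ N := by
    have h := pow_le_pow_left₀ (by positivity) hN.le N
    rwa [one_div, Real.rpow_inv_natCast_pow (norm_nonneg _) (by lia)] at h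
  have hmap : (M.map (fun x : ℝ => (x : ℂ))) ^ N = (M ^ N).map (fun x : ℝ => (x : ℂ)) :=
    (map_pow (Complex.ofRealHom.mapMatrix) M N).symm
  have hrow : ∀ j, ((M ^ N).mulVec 1) j ≤ τ ^ N := by
    intro j
    refine le_trans ?_ hnorm
    rw [hmap, Matrix.linfty_opNorm_def]
    have h1 : ∑ l, ‖(M ^ N).map (fun x : ℝ => (x : ℂ)) j l‖₊ ≤
        univ.sup fun i => ∑ l, ‖(M ^ N).map (fun x : ℝ => (x : ℂ)) i l‖₊ :=
      le_sup (f := fun i => ∑ l, ‖(M ^ N).map (fun x : ℝ => (x : ℂ)) i l‖₊) (mem_univ j)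
    refine le_trans ?_ (NNReal.coe_le_coe.2 h1)
    rw [NNReal.coe_sum, Matrix.mulVec, dotProduct]
    refine sum_le_sum fun l _ => ?_
    simpa using le_abs_self ((M ^ N) j l)
  have hpow : ∀ n j, 0 ≤ ((M ^ n).mulVec 1) j := fun n j => by
    rw [Matrix.mulVec, dotProduct]
    exact sum_nonneg fun l _ => by simpa using Matrix.pow_apply_nonneg hM n j l
  -- For this truncated Neumann series v, the sum telescopes to Mv = τ(v − 1 + τ⁻ᴺM^N 1) ≤ τv; the
  -- term n = 0 gives v ≥ 1.
  refine ⟨∑ n ∈ range N, (τ⁻¹) ^ n • (M ^ n).mulVec 1, fun j => ?_, fun j => ?_⟩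
  · obtain ⟨m, rfl⟩ := Nat.exists_eq_add_of_le' hN1
    rw [sum_range_succ', Pi.add_apply, Finset.sum_apply]
    simp only [pow_zero, one_smul, Matrix.one_mulVec, Pi.one_apply, le_add_iff_nonneg_left]
    refine sum_nonneg fun n _ => ?_
    have := hpow (n + 1) j
    simp only [Pi.smul_apply, smul_eq_mul]
    positivity
  · have h1 : M.mulVec (∑ n ∈ range N, (τ⁻¹) ^ n • (M ^ n).mulVec 1) =
        τ • ∑ n ∈ range N, (τ⁻¹) ^ (n + 1) • (M ^ (n + 1)).mulVec 1 := by
      rw [Matrix.mulVec_sum, smul_sum]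
      refine sum_congr rfl fun n _ => ?_
      rw [Matrix.mulVec_smul, Matrix.mulVec_mulVec, ← pow_succ', smul_smul]
      rw [pow_succ' τ⁻¹, ← mul_assoc, mul_inv_cancel₀ hτ0.ne', one_mul]
    have h2 := sum_range_succ' (fun n => (τ⁻¹) ^ n • (M ^ n).mulVec (1 : S → ℝ)) N
    rw [sum_range_succ] at h2
    have h3 := congrFun h2 j
    have h4 : (τ⁻¹) ^ N * ((M ^ N).mulVec 1) j ≤ 1 := by
      rw [inv_pow, inv_mul_le_iff₀ (by positivity), mul_one]
      exact hrow j
    simp only [pow_zero, one_smul, Matrix.one_mulVec, Pi.add_apply, Pi.one_apply, Pi.smul_apply,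
      smul_eq_mul] at h3
    rw [h1, Pi.smul_apply, smul_eq_mul]
    exact mul_le_mul_of_nonneg_left (by linarith) hτ0.le

/-- The quotient `(C(exp s₁, exp s₂) h) j / h j` for `h = exp u`, where `p = ((s₁, s₂), u)`. -/
noncomputable def load (A : ℤ → ℤ → Matrix S S ℝ) (p : (ℝ × ℝ) × (S → ℝ)) (j : S) : ℝ :=
  ∑ i ∈ ℍ, ∑ k ∈ ℍ, ∑ l, A i k j l * Real.exp (p.1.1 * i + p.1.2 * k + p.2 l - p.2 j)

/-- The `((s₁, s₂), u)` for which `h = exp u` satisfies `C(exp s₁, exp s₂) h ≤ τ h`. -/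
def subinvariant (A : ℤ → ℤ → Matrix S S ℝ) (τ : ℝ) : Set ((ℝ × ℝ) × (S → ℝ)) :=
  {p | ∀ j, load A p j ≤ τ}

lemma continuous_load (A : ℤ → ℤ → Matrix S S ℝ) (j : S) : Continuous fun p => load A p j := by
  unfold load
  fun_prop

lemma isClosed_subinvariant (A : ℤ → ℤ → Matrix S S ℝ) (τ : ℝ) : IsClosed (subinvariant A τ) := by
  simp only [subinvariant, Set.ofPred_forall]
  exact isClosed_iInter fun j => isClosed_le (continuous_load A j) continuous_const

/-- In logarithmic coordinates each load is a nonnegative combination of exponentials of linear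
forms, hence convex. -/
lemma convex_subinvariant (hA : ∀ i ∈ ℍ, ∀ j ∈ ℍ, ∀ k l : S, 0 ≤ A i j k l) (τ : ℝ) :
    Convex ℝ (subinvariant A τ) := by
  intro p hp q hq a b ha hb hab j
  have h1 : load A (a • p + b • q) j ≤ a * load A p j + b * load A q j := by
    simp only [load, mul_sum, ← sum_add_distrib]
    refine sum_le_sum fun i hi => sum_le_sum fun k hk => sum_le_sum fun l _ => ?_
    have h := convexOn_exp.2 (Set.mem_univ (p.1.1 * i + p.1.2 * k + p.2 l - p.2 j))
      (Set.mem_univ (q.1.1 * i + q.1.2 * k + q.2 l - q.2 j)) ha hb hab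
    have h' := mul_le_mul_of_nonneg_left h (hA i hi k hk j l)
    simp only [smul_eq_mul] at h'
    have e : (a • p + b • q).1.1 * i + (a • p + b • q).1.2 * k + (a • p + b • q).2 l -
        (a • p + b • q).2 j = a * (p.1.1 * i + p.1.2 * k + p.2 l - p.2 j) +
          b * (q.1.1 * i + q.1.2 * k + q.2 l - q.2 j) := by
      simp
      ring
    rw [e]
    linarith
  have h2 := mul_le_mul_of_nonneg_left (hp j) ha
  have h3 := mul_le_mul_of_nonneg_left (hq j) hb
  calc _ ≤ _ := h1
    _ ≤ a * τ + b * τ := add_le_add h2 h3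
    _ = τ := by rw [← add_mul, hab, one_mul]

/-- A transition of probability α > 0 is one term of the load, so its exponent e satisfies α exp e ≤
τ. Exponents add up along a path, and the bound is uniform in p. -/
lemma exists_bound_of_reflTransGen (hA : ∀ i ∈ ℍ, ∀ j ∈ ℍ, ∀ k l : S, 0 ≤ A i j k l) (τ : ℝ)
    {x y : ℤ × ℤ × S} (h : Relation.ReflTransGen (fun x y => 0 < transitionMatrix A x y) x y) :
    ∃ c : ℝ, ∀ p ∈ subinvariant A τ,
      p.1.1 * (y.1 - x.1) + p.1.2 * (y.2.1 - x.2.1) + p.2 y.2.2 - p.2 x.2.2 ≤ c := by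
  induction h with
  | refl => exact ⟨0, fun p _ => by simp⟩
  | @tail y t _ hyt ih =>
    obtain ⟨c, hc⟩ := ih
    obtain ⟨h1, h2, hpos⟩ := transitionMatrix_pos hyt
    set α := A (t.1 - y.1) (t.2.1 - y.2.1) y.2.2 t.2.2
    -- From e + 1 ≤ exp e ≤ τ/α; the sharper log(τ/α) is not needed.
    refine ⟨c + τ / α, fun p hp => ?_⟩
    have hterm : α * Real.exp (p.1.1 * (t.1 - y.1 : ℤ) + p.1.2 * (t.2.1 - y.2.1 : ℤ) + p.2 t.2.2 -
        p.2 y.2.2) ≤ load A p y.2.2 := by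
      have n1 : ∀ i ∈ ℍ, ∀ k ∈ ℍ, ∀ l, 0 ≤ A i k y.2.2 l *
          Real.exp (p.1.1 * i + p.1.2 * k + p.2 l - p.2 y.2.2) := fun i hi k hk l =>
        mul_nonneg (hA i hi k hk _ _) (Real.exp_pos _).le
      refine le_trans ?_ (single_le_sum (fun i hi => sum_nonneg fun k hk =>
        sum_nonneg fun l _ => n1 i hi k hk l) h1)
      refine le_trans ?_ (single_le_sum (fun k hk => sum_nonneg fun l _ => n1 _ h1 k hk l) h2)
      exact single_le_sum (f := fun l => A (t.1 - y.1) (t.2.1 - y.2.1) y.2.2 l *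
        Real.exp (p.1.1 * (t.1 - y.1 : ℤ) + p.1.2 * (t.2.1 - y.2.1 : ℤ) + p.2 l - p.2 y.2.2))
        (fun l _ => n1 _ h1 _ h2 l) (mem_univ t.2.2)
    have h3 := (le_div_iff₀' hpos).2 (hterm.trans (hp y.2.2))
    have h4 := Real.add_one_le_exp (p.1.1 * (t.1 - y.1 : ℤ) + p.1.2 * (t.2.1 - y.2.1 : ℤ) +
      p.2 t.2.2 - p.2 y.2.2)
    have h5 := hc p hp
    push_cast at h3 h4
    linarith

/-- Fixing u at j₀ removes the scaling of h. Paths from (0,0,j₀) to its four neighbours with the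
same j₀ bound s₁ and s₂ on both sides; paths between j₀ and l over the origin bound u l. -/
lemma isCompact_normalized_subinvariant (hA : ∀ i ∈ ℍ, ∀ j ∈ ℍ, ∀ k l : S, 0 ≤ A i j k l)
    (hI : (transitionMatrix A).IsIrreducible) (τ : ℝ) (j₀ : S) :
    IsCompact (subinvariant A τ ∩ {p | p.2 j₀ = 0}) := by
  have H := fun x y => exists_bound_of_reflTransGen hA τ (reflTransGen_of_isIrreducible hI x y)
  choose c hc using H
  refine (isCompact_Icc (a := ((-c (0, 0, j₀) (-1, 0, j₀), -c (0, 0, j₀) (0, -1, j₀)),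
    fun l => -c (0, 0, l) (0, 0, j₀))) (b := ((c (0, 0, j₀) (1, 0, j₀), c (0, 0, j₀) (0, 1, j₀)),
    fun l => c (0, 0, j₀) (0, 0, l)))).of_isClosed_subset
    ((isClosed_subinvariant A τ).inter (isClosed_eq (by fun_prop) continuous_const)) ?_
  rintro p ⟨hp, h0⟩
  have h0' : p.2 j₀ = 0 := h0
  have b := fun x y => hc x y p hp
  refine ⟨⟨⟨?_, ?_⟩, fun l => ?_⟩, ⟨⟨?_, ?_⟩, fun l => ?_⟩⟩
  · have := b (0, 0, j₀) (-1, 0, j₀)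
    norm_num at this
    show -c (0, 0, j₀) (-1, 0, j₀) ≤ p.1.1
    linarith
  · have := b (0, 0, j₀) (0, -1, j₀)
    norm_num at this
    show -c (0, 0, j₀) (0, -1, j₀) ≤ p.1.2
    linarith
  · have := b (0, 0, l) (0, 0, j₀)
    norm_num [h0'] at this
    show -c (0, 0, l) (0, 0, j₀) ≤ p.2 l
    linarith
  · have := b (0, 0, j₀) (1, 0, j₀)
    norm_num at this
    exact this
  · have := b (0, 0, j₀) (0, 1, j₀)
    norm_num at this
    exact this
  · have := b (0, 0, j₀) (0, 0, l)
    norm_num [h0'] at this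
    exact this

lemma exists_load_le_of_mem_Γbar [DecidableEq S] (hA : ∀ i ∈ ℍ, ∀ j ∈ ℍ, ∀ k l : S, 0 ≤ A i j k l) (j₀ : S)
    {s : ℝ × ℝ} (hs : s ∈ Γbar A) {τ : ℝ} (hτ : 1 < τ) :
    ∃ u : S → ℝ, u j₀ = 0 ∧ (s, u) ∈ subinvariant A τ := by
  set M : Matrix S S ℝ := ∑ i ∈ ℍ, ∑ k ∈ ℍ, Real.exp (s.1 * i + s.2 * k) • A i k with hM
  have hMj : ∀ j l, M j l = ∑ i ∈ ℍ, ∑ k ∈ ℍ, Real.exp (s.1 * i + s.2 * k) * A i k j l := by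
    intro j l
    simp [hM, Matrix.sum_apply]
  have hmap : M.map (fun x : ℝ => (x : ℂ)) = C A (Real.exp s.1) (Real.exp s.2) := by
    ext j l
    rw [Matrix.map_apply, hMj]
    simp only [C, Matrix.sum_apply, Matrix.smul_apply, Matrix.map_apply, smul_eq_mul,
      Complex.ofReal_sum, Complex.ofReal_mul]
    refine sum_congr rfl fun i _ => sum_congr rfl fun k _ => ?_
    rw [Real.exp_add, Real.exp_mul, Real.exp_mul, Real.rpow_intCast, Real.rpow_intCast]
    push_cast
    rfl
  have hn : ∀ j l, 0 ≤ M j l := fun j l => by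
    rw [hMj]
    exact sum_nonneg fun i hi => sum_nonneg fun k hk =>
      mul_nonneg (Real.exp_pos _).le (hA i hi k hk j l)
  obtain ⟨v, hv1, hv⟩ := exists_mulVec_le_of_spectralRadius_le_one hn (by rw [hmap]; exact hs) hτ
  have hv0 : ∀ j, 0 < v j := fun j => zero_lt_one.trans_le (hv1 j)
  refine ⟨fun j => Real.log (v j) - Real.log (v j₀), sub_self _, fun j => ?_⟩
  have e : load A (s, fun j => Real.log (v j) - Real.log (v j₀)) j = (M.mulVec v) j / v j := by
    rw [Matrix.mulVec, dotProduct, sum_div]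
    simp only [hMj, load, sum_mul, sum_div]
    rw [sum_congr rfl fun i _ => sum_comm, sum_comm]
    refine sum_congr rfl fun l _ => sum_congr rfl fun i _ => sum_congr rfl fun k _ => ?_
    rw [show s.1 * i + s.2 * k + (Real.log (v l) - Real.log (v j₀)) -
      (Real.log (v j) - Real.log (v j₀)) = (s.1 * i + s.2 * k) + (Real.log (v l) - Real.log (v j))
      by ring, Real.exp_add, Real.exp_sub, Real.exp_log (hv0 l), Real.exp_log (hv0 j)]
    ring
  rw [e, div_le_iff₀ (hv0 j)]
  exact hv j

lemma exists_subinvariant_of_mem_Γbar [DecidableEq S] (hA : ∀ i ∈ ℍ, ∀ j ∈ ℍ, ∀ k l : S, 0 ≤ A i j k l)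
    (hI : (transitionMatrix A).IsIrreducible) (j₀ : S) {s : ℝ × ℝ} (hs : s ∈ Γbar A) :
    ∃ u : S → ℝ, u j₀ = 0 ∧ (s, u) ∈ subinvariant A 1 := by
  have hτ : ∀ n : ℕ, (1 : ℝ) < 1 + 1 / ((n : ℝ) + 1) := fun n => by
    have : (0 : ℝ) < 1 / ((n : ℝ) + 1) := by positivity
    linarith
  -- All these vectors lie in the compact set for τ = 2; a limit point satisfies the bound with τ =
  -- 1.
  choose u hu0 hu using fun n => exists_load_le_of_mem_Γbar hA j₀ hs (hτ n)
  have hmem : ∀ n, (s, u n) ∈ subinvariant A 2 ∩ {p | p.2 j₀ = 0} := fun n => by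
    refine ⟨fun j => (hu n j).trans ?_, hu0 n⟩
    have : 1 / ((n : ℝ) + 1) ≤ 1 := by
      rw [div_le_one (by positivity)]
      linarith [(Nat.cast_nonneg n : (0 : ℝ) ≤ n)]
    linarith
  obtain ⟨p, hp, φ, hφ, hlim⟩ :=
    (isCompact_normalized_subinvariant hA hI 2 j₀).tendsto_subseq hmem
  have hp1 : p.1 = s := by
    have := (continuous_fst.tendsto p).comp hlim
    exact tendsto_nhds_unique this tendsto_const_nhds
  refine ⟨p.2, hp.2, fun j => ?_⟩
  rw [← hp1]
  have h1 := ((continuous_load A j).tendsto p).comp hlim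
  have h2 : Tendsto (fun n : ℕ => 1 + 1 / ((n : ℝ) + 1)) atTop (𝓝 1) := by
    simpa using tendsto_one_div_add_atTop_nhds_zero_nat.const_add (1 : ℝ)
  exact le_of_tendsto_of_tendsto' h1 (h2.comp hφ.tendsto_atTop) fun n => hu (φ n) j

lemma exists_subinvariant_of_mem_Icc [DecidableEq S] [Nonempty S]
    (hA : ∀ i ∈ ℍ, ∀ j ∈ ℍ, ∀ k l : S, 0 ≤ A i j k l)
    (hS : blockSum A ∈ Matrix.rowStochastic ℝ S)
    (hI : (transitionMatrix A).IsIrreducible) {x : ℝ} (h1 : zLow₁ A ≤ x) (h2 : x ≤ zHigh₁ A) :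
    ∃ (s₂ : ℝ) (u : S → ℝ), ((Real.log x, s₂), u) ∈ subinvariant A 1 := by
  obtain ⟨j₀⟩ := ‹Nonempty S›
  set K := (fun p : (ℝ × ℝ) × (S → ℝ) => p.1.1) '' (subinvariant A 1 ∩ {p | p.2 j₀ = 0}) with hK
  have hx : 0 < x := (Real.exp_pos _).trans_le h1
  have hcomp : IsCompact K :=
    (isCompact_normalized_subinvariant hA hI 1 j₀).image (by fun_prop)
  have hconv : Convex ℝ K := by
    have h3 : Convex ℝ {p : (ℝ × ℝ) × (S → ℝ) | p.2 j₀ = 0} :=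
      fun p hp q hq a b _ _ _ => by
        have hp' : p.2 j₀ = 0 := hp
        have hq' : q.2 j₀ = 0 := hq
        simp [hp', hq']
    exact ((convex_subinvariant hA 1).inter h3).linear_image
      ((LinearMap.fst ℝ ℝ ℝ).comp (LinearMap.fst ℝ (ℝ × ℝ) (S → ℝ)))
  -- Stochasticity makes h = 1 invariant at s = 0. Having 0 in K also covers the default value 0 of
  -- `sSup` and `sInf`, so nonemptiness of `Γbar` is not needed.
  have h0 : (0 : ℝ) ∈ K := by
    refine ⟨((0, 0), 0), ⟨fun j => le_of_eq ?_, rfl⟩, rfl⟩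
    have h4 := (Matrix.mem_rowStochastic_iff_sum.1 hS).2 j
    rw [← h4]
    simp only [load, blockSum, Matrix.sum_apply]
    symm
    refine sum_comm.trans (sum_congr rfl fun i _ => sum_comm.trans ?_)
    simp
  have hsub : Prod.fst '' Γbar A ⊆ K := by
    rintro _ ⟨s, hs, rfl⟩
    obtain ⟨u, hu0, hu⟩ := exists_subinvariant_of_mem_Γbar hA hI j₀ hs
    exact ⟨(s, u), ⟨hu, hu0⟩, rfl⟩
  have hsup : sSup (Prod.fst '' Γbar A) ≤ sSup K :=
    Real.sSup_le (fun y hy => le_csSup hcomp.bddAbove (hsub hy)) (le_csSup hcomp.bddAbove h0)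
  have hinf : sInf K ≤ sInf (Prod.fst '' Γbar A) :=
    Real.le_sInf (fun y hy => csInf_le hcomp.bddBelow (hsub hy)) (csInf_le hcomp.bddBelow h0)
  have hmem : Real.log x ∈ K := by
    refine hconv.ordConnected.out (hcomp.sInf_mem ⟨0, h0⟩) (hcomp.sSup_mem ⟨0, h0⟩) ⟨?_, ?_⟩
    · exact hinf.trans ((Real.le_log_iff_exp_le hx).2 h1)
    · exact ((Real.log_le_iff_le_exp hx).2 h2).trans hsup
  obtain ⟨⟨⟨s₁, s₂⟩, u⟩, ⟨hp, -⟩, hs₁⟩ := hmem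
  exact ⟨s₂, u, hs₁ ▸ hp⟩

end Subinvariance

/-! ### Entrywise summability of excursion weights. -/

section Convergence

variable {S : Type*}

lemma summable_matrix {f : ℕ → Matrix S S ℂ} (hf : ∀ k l, Summable fun n => ‖f n k l‖) :
    Summable f :=
  Pi.summable.2 fun k => Pi.summable.2 fun l => (hf k l).of_norm

lemma tsum_matrix_apply {f : ℕ → Matrix S S ℂ} (hf : Summable f) (k l : S) :
    (∑' n, f n) k l = ∑' n, f n k l :=
  (congrFun (tsum_apply hf (x := k)) l).trans (tsum_apply (Pi.summable.1 hf k))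

lemma norm_tsum_matrix_le {f : ℕ → Matrix S S ℂ} {g : ℕ → Matrix S S ℝ}
    (h : ∀ n k l, ‖f n k l‖ ≤ g n k l) (hg : ∀ k l, Summable fun n => g n k l) (k l : S) :
    ‖(∑' n, f n) k l‖ ≤ ∑' n, g n k l := by
  have hf : ∀ k l, Summable fun n => ‖f n k l‖ := fun k l =>
    (hg k l).of_nonneg_of_le (fun n => norm_nonneg _) fun n => h n k l
  rw [tsum_matrix_apply (summable_matrix hf)]
  exact tsum_of_norm_bounded (hg k l).hasSum fun n => h n k l

variable [Fintype S]

lemma summable_norm_matrix_mul {f : ℕ → Matrix S S ℂ} (hf : ∀ k l, Summable fun n => ‖f n k l‖)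
    (M : Matrix S S ℂ) (k l : S) : Summable fun n => ‖(f n * M) k l‖ := by
  refine Summable.of_nonneg_of_le (fun n => norm_nonneg _) (fun n => norm_sum_le _ _)
    (summable_sum fun p _ => ?_)
  simp only [norm_mul]
  exact (hf k p).mul_right _

lemma summable_norm_mul_matrix {f : ℕ → Matrix S S ℂ} (hf : ∀ k l, Summable fun n => ‖f n k l‖)
    (M : Matrix S S ℂ) (k l : S) : Summable fun n => ‖(M * f n) k l‖ := by
  refine Summable.of_nonneg_of_le (fun n => norm_nonneg _) (fun n => norm_sum_le _ _)
    (summable_sum fun p _ => ?_)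
  simp only [norm_mul]
  exact (hf p l).mul_left _

lemma hasSum_antidiagonal_matrix {f g : ℕ → Matrix S S ℂ}
    (hf : ∀ k l, Summable fun n => ‖f n k l‖) (hg : ∀ k l, Summable fun n => ‖g n k l‖) :
    HasSum (fun n => ∑ p ∈ antidiagonal n, f p.1 * g p.2) ((∑' n, f n) * ∑' n, g n) := by
  refine Pi.hasSum.2 fun k => Pi.hasSum.2 fun l => ?_
  simp only [Matrix.mul_apply, tsum_matrix_apply (summable_matrix hf),
    tsum_matrix_apply (summable_matrix hg), Matrix.sum_apply]
  simp only [sum_comm (t := univ)]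
  refine hasSum_sum fun p _ => ?_
  have hs := summable_norm_sum_mul_antidiagonal_of_summable_norm (hf k p) (hg p l)
  rw [tsum_mul_tsum_eq_tsum_sum_antidiagonal_of_summable_norm (hf k p) (hg p l)]
  exact hs.of_norm.hasSum

lemma mulVec_mono_of_nonneg {M : Matrix S S ℝ} (hM : ∀ k l, 0 ≤ M k l) {u v : S → ℝ} (h : u ≤ v) :
    M.mulVec u ≤ M.mulVec v :=
  fun k => sum_le_sum fun l _ => mul_le_mul_of_nonneg_left (h l) (hM k l)

lemma mulVec_nonneg {M : Matrix S S ℝ} (hM : ∀ k l, 0 ≤ M k l) {u : S → ℝ} (h : 0 ≤ u) :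
    0 ≤ M.mulVec u :=
  fun k => sum_nonneg fun l _ => mul_nonneg (hM k l) (h l)

lemma mul_le_mulVec {M : Matrix S S ℝ} (hM : ∀ k l, 0 ≤ M k l) {u : S → ℝ} (h : 0 ≤ u) (k l : S) :
    M k l * u l ≤ M.mulVec u k :=
  single_le_sum (f := fun l => M k l * u l) (fun l _ => mul_nonneg (hM k l) (h l)) (mem_univ l)

variable [DecidableEq S] {B : ℤ → Matrix S S ℝ}

lemma excursion_nonneg (hB : ∀ j ∈ ℍ, ∀ k l, 0 ≤ B j k l) (n a : ℕ) (k l : S) :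
    0 ≤ excursion B n a k l := by
  have hmul : ∀ {M N : Matrix S S ℝ}, (∀ k l, 0 ≤ M k l) → (∀ k l, 0 ≤ N k l) →
      ∀ k l, 0 ≤ (M * N) k l := fun hM hN k l => sum_nonneg fun p _ => mul_nonneg (hM k p) (hN p l)
  have b1 := hB (-1) (by decide)
  have b2 := hB 0 (by decide)
  have b3 := hB 1 (by decide)
  induction n generalizing a k l with
  | zero =>
    unfold excursion
    split_ifs
    · rw [Matrix.one_apply]
      split_ifs <;> simp
    · simp
  | succ n ih =>
    cases a with
    | zero => exact add_nonneg (hmul b2 (ih 0) k l) (hmul b3 (ih 1) k l)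
    | succ a =>
      exact add_nonneg (add_nonneg (hmul b1 (ih a) k l) (hmul b2 (ih _) k l)) (hmul b3 (ih _) k l)

lemma mulVec_excursion_le_succ (hB : ∀ j ∈ ℍ, ∀ k l, 0 ≤ B j k l) {v : S → ℝ} (hv : 0 ≤ v) (n : ℕ)
    {a b : ℕ} {j : ℤ} (hj : j ∈ ℍ) (hab : (b : ℤ) - a = j) :
    (B j).mulVec ((excursion B n b).mulVec v) ≤ (excursion B (n + 1) a).mulVec v := by
  have hn : ∀ i ∈ ℍ, ∀ b, 0 ≤ (B i).mulVec ((excursion B n b).mulVec v) := fun i hi b =>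
    mulVec_nonneg (hB i hi) (mulVec_nonneg (excursion_nonneg hB n b) hv)
  cases a with
  | zero =>
    rw [excursion_succ_zero, Matrix.add_mulVec, ← Matrix.mulVec_mulVec, ← Matrix.mulVec_mulVec]
    rcases mem_displacements.1 hj with rfl | rfl | rfl
    · exfalso
      lia
    · obtain rfl : b = 0 := by lia
      exact le_add_of_nonneg_right (hn _ (by decide) _)
    · obtain rfl : b = 1 := by lia
      exact le_add_of_nonneg_left (hn _ (by decide) _)
  | succ a =>
    rw [excursion_succ_succ, Matrix.add_mulVec, Matrix.add_mulVec, ← Matrix.mulVec_mulVec,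
      ← Matrix.mulVec_mulVec, ← Matrix.mulVec_mulVec]
    rcases mem_displacements.1 hj with rfl | rfl | rfl
    · obtain rfl : b = a := by lia
      exact le_add_of_le_of_nonneg (le_add_of_nonneg_right (hn _ (by decide) _)) (hn _ (by decide) _)
    · obtain rfl : b = a + 1 := by lia
      exact le_add_of_le_of_nonneg (le_add_of_nonneg_left (hn _ (by decide) _)) (hn _ (by decide) _)
    · obtain rfl : b = a + 2 := by lia
      exact le_add_of_nonneg_left (add_nonneg (hn _ (by decide) _) (hn _ (by decide) _))

/-- Concatenating a walk from `a` to `0` with one from `0` to `0` gives a walk from `a` to `0`. -/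
lemma excursion_mulVec_excursion_le (hB : ∀ j ∈ ℍ, ∀ k l, 0 ≤ B j k l) {v : S → ℝ} (hv : 0 ≤ v)
    (n m a : ℕ) :
    (excursion B n a).mulVec ((excursion B m 0).mulVec v) ≤ (excursion B (n + m) a).mulVec v := by
  induction n generalizing a with
  | zero =>
    cases a with
    | zero => simp [excursion]
    | succ a =>
      simpa [excursion] using mulVec_nonneg (excursion_nonneg hB m (a + 1)) hv
  | succ n ih =>
    have key : ∀ j ∈ ℍ, ∀ b, (B j).mulVec ((excursion B n b).mulVec ((excursion B m 0).mulVec v)) ≤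
        (B j).mulVec ((excursion B (n + m) b).mulVec v) := fun j hj b =>
      mulVec_mono_of_nonneg (hB j hj) (ih b)
    rw [show n + 1 + m = (n + m) + 1 by ring]
    cases a with
    | zero =>
      simp only [excursion_succ_zero, Matrix.add_mulVec, ← Matrix.mulVec_mulVec] at key ⊢
      exact add_le_add (key 0 (by decide) _) (key 1 (by decide) _)
    | succ a =>
      simp only [excursion_succ_succ, Matrix.add_mulVec, ← Matrix.mulVec_mulVec] at key ⊢
      exact add_le_add (add_le_add (key (-1) (by decide) _) (key 0 (by decide) _))
        (key 1 (by decide) _)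

/-- A subinvariant vector bounds the total weight of the walks up to the first passage to `-1`. -/
lemma sum_excursion_mulVec_le (hB : ∀ j ∈ ℍ, ∀ k l, 0 ≤ B j k l) {h : S → ℝ} (hh : 0 ≤ h) {w : ℝ}
    (hw : 0 < w)
    (hsub : (B (-1)).mulVec h + w • (B 0).mulVec h + w ^ 2 • (B 1).mulVec h ≤ w • h) (m a : ℕ) :
    ∑ n ∈ range m, (excursion B n a).mulVec ((B (-1)).mulVec h) ≤ w ^ (a + 1) • h := by
  induction m generalizing a with
  | zero =>
    simp only [range_zero, sum_empty]
    exact smul_nonneg (by positivity) hh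
  | succ m ih =>
    have key : ∀ j ∈ ℍ, ∀ b, (B j).mulVec (∑ n ∈ range m,
        (excursion B n b).mulVec ((B (-1)).mulVec h)) ≤ w ^ (b + 1) • (B j).mulVec h :=
      fun j hj b => by
        rw [← Matrix.mulVec_smul]
        exact mulVec_mono_of_nonneg (hB j hj) (ih b)
    have k1 := key (-1) (by decide)
    have k2 := key 0 (by decide)
    have k3 := key 1 (by decide)
    simp only [Matrix.mulVec_sum] at k1 k2 k3
    rw [sum_range_succ']
    cases a with
    | zero =>
      simp only [excursion_succ_zero, Matrix.add_mulVec, ← Matrix.mulVec_mulVec, sum_add_distrib]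
      -- At level 0 the term n = 0 equals B₋₁h and stands for the immediate step down; at higher
      -- levels that term vanishes.
      refine (add_le_add (add_le_add (k2 0) (k3 1)) le_rfl).trans ?_
      refine le_trans (le_of_eq ?_) (hsub.trans_eq ?_)
      · simp [excursion]
        abel
      · simp
    | succ a =>
      simp only [excursion_succ_succ, Matrix.add_mulVec, ← Matrix.mulVec_mulVec, sum_add_distrib]
      refine (add_le_add (add_le_add (add_le_add (k1 a) (k2 (a + 1))) (k3 (a + 2))) le_rfl).trans ?_
      refine le_trans (le_of_eq ?_) ((smul_le_smul_of_nonneg_left hsub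
        (pow_nonneg hw.le (a + 1))).trans_eq ?_)
      · simp only [excursion, smul_add, smul_smul]
        simp
        ring_nf
      · rw [smul_smul, ← pow_succ]

lemma summable_excursion_mulVec (hB : ∀ j ∈ ℍ, ∀ k l, 0 ≤ B j k l) {h : S → ℝ} (hh : 0 ≤ h) {w : ℝ}
    (hw : 0 < w)
    (hsub : (B (-1)).mulVec h + w • (B 0).mulVec h + w ^ 2 • (B 1).mulVec h ≤ w • h) (k : S) :
    Summable fun n => (excursion B n 0).mulVec ((B (-1)).mulVec h) k := by
  refine summable_of_sum_range_le (c := (w ^ (0 + 1) • h) k) (fun n => ?_) fun m => ?_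
  · exact mulVec_nonneg (excursion_nonneg hB n 0) (mulVec_nonneg (hB _ (by decide)) hh) k
  · have := sum_excursion_mulVec_le hB hh hw hsub m 0 k
    rwa [Finset.sum_apply] at this

/-- Follow a path of positive transitions only up to its first visit to level −1, which a skip-free
walk enters from level 0. -/
lemma exists_excursion_mulVec_pos {A : ℤ → ℤ → Matrix S S ℝ} (hB : ∀ j ∈ ℍ, ∀ k l, 0 ≤ B j k l)
    (hAB : ∀ i ∈ ℍ, ∀ j ∈ ℍ, ∀ k l, 0 < A i j k l → 0 < B j k l) {h : S → ℝ} (hh : ∀ l, 0 < h l)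
    {x y : ℤ × ℤ × S} (hy : y.2.1 = -1)
    (hxy : Relation.ReflTransGen (fun x y => 0 < transitionMatrix A x y) x y) (a : ℕ)
    (ha : x.2.1 = a) :
    ∃ m, 0 < (excursion B m a).mulVec ((B (-1)).mulVec h) x.2.2 := by
  have hv : 0 ≤ (B (-1)).mulVec h :=
    mulVec_nonneg (hB _ (by decide)) fun l => (hh l).le
  induction hxy using Relation.ReflTransGen.head_induction_on generalizing a with
  | refl => lia
  | @head x t hxt _ ih =>
    obtain ⟨h1, h2, hpos⟩ := transitionMatrix_pos hxt
    have hBpos := hAB _ h1 _ h2 _ _ hpos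
    by_cases ht : t.2.1 = -1
    · obtain rfl : a = 0 := by
        rw [mem_displacements] at h2
        lia
      refine ⟨0, ?_⟩
      have e : t.2.1 - x.2.1 = -1 := by lia
      rw [e] at hBpos
      simpa [excursion] using (mul_pos hBpos (hh t.2.2)).trans_le
        (mul_le_mulVec (hB (-1) (by decide)) (fun l => (hh l).le) x.2.2 t.2.2)
    · obtain ⟨b, hb⟩ : ∃ b : ℕ, t.2.1 = b := by
        rw [mem_displacements] at h2
        exact ⟨t.2.1.toNat, by lia⟩
      obtain ⟨m, hm⟩ := ih b hb
      refine ⟨m + 1, ?_⟩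
      refine ((mul_pos hBpos hm).trans_le (mul_le_mulVec (hB _ h2)
        (mulVec_nonneg (excursion_nonneg hB m b) hv) x.2.2 t.2.2)).trans_le ?_
      exact mulVec_excursion_le_succ hB hv m h2 (by lia) x.2.2

/-- With v = B₋₁h, choose m such that (Q⁽ᵐ⁾v)_l > 0. Then [Q⁽ⁿ⁾]_{kl}(Q⁽ᵐ⁾v)_l ≤ (Q⁽ⁿ⁺ᵐ⁾v)_k, which
is summable in n. -/
lemma summable_excursion {A : ℤ → ℤ → Matrix S S ℝ} (hI : (transitionMatrix A).IsIrreducible)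
    (hB : ∀ j ∈ ℍ, ∀ k l, 0 ≤ B j k l)
    (hAB : ∀ i ∈ ℍ, ∀ j ∈ ℍ, ∀ k l, 0 < A i j k l → 0 < B j k l) {h : S → ℝ} (hh : ∀ l, 0 < h l)
    {w : ℝ} (hw : 0 < w)
    (hsub : (B (-1)).mulVec h + w • (B 0).mulVec h + w ^ 2 • (B 1).mulVec h ≤ w • h) (k l : S) :
    Summable fun n => excursion B n 0 k l := by
  have hh0 : 0 ≤ h := fun l => (hh l).le
  have hv : 0 ≤ (B (-1)).mulVec h := mulVec_nonneg (hB _ (by decide)) hh0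
  obtain ⟨m, hm⟩ := exists_excursion_mulVec_pos hB hAB hh (x := (0, 0, l)) (y := (0, -1, l)) rfl
    (reflTransGen_of_isIrreducible hI _ _) 0 rfl
  have hs := (summable_nat_add_iff m).2 (summable_excursion_mulVec hB hh0 hw hsub k)
  refine (summable_mul_right_iff hm.ne').1 (hs.of_nonneg_of_le (fun n => ?_) fun n => ?_)
  · exact mul_nonneg (excursion_nonneg hB n 0 k l) hm.le
  · exact (mul_le_mulVec (excursion_nonneg hB n 0) (mulVec_nonneg (excursion_nonneg hB m 0) hv)
      k l).trans (excursion_mulVec_excursion_le hB hv n m 0 k)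

lemma norm_excursion_le {B' : ℤ → Matrix S S ℂ} (h : ∀ j ∈ ℍ, ∀ k l, ‖B' j k l‖ ≤ B j k l)
    (n a : ℕ) (k l : S) : ‖excursion B' n a k l‖ ≤ excursion B n a k l := by
  have hmul : ∀ {M : Matrix S S ℂ} {M' : Matrix S S ℝ} {N : Matrix S S ℂ} {N' : Matrix S S ℝ},
      (∀ k l, ‖M k l‖ ≤ M' k l) → (∀ k l, ‖N k l‖ ≤ N' k l) →
      ∀ k l, ‖(M * N) k l‖ ≤ (M' * N') k l := by
    intro M M' N N' hM hN k l
    refine (norm_sum_le _ _).trans (sum_le_sum fun p _ => ?_)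
    rw [norm_mul]
    exact mul_le_mul (hM k p) (hN p l) (norm_nonneg _) ((norm_nonneg _).trans (hM k p))
  have b1 := h (-1) (by decide)
  have b2 := h 0 (by decide)
  have b3 := h 1 (by decide)
  induction n generalizing a k l with
  | zero =>
    unfold excursion
    split_ifs
    · rw [Matrix.one_apply, Matrix.one_apply]
      split_ifs <;> simp
    · simp
  | succ n ih =>
    cases a with
    | zero => exact norm_add_le_of_le (hmul b2 (ih 0) k l) (hmul b3 (ih 1) k l)
    | succ a =>
      exact norm_add_le_of_le (norm_add_le_of_le (hmul b1 (ih a) k l) (hmul b2 (ih _) k l))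
        (hmul b3 (ih _) k l)

lemma map_excursion {M N : Type*} [Semiring M] [Semiring N] (f : M →+* N) (B : ℤ → M) (n a : ℕ) :
    f (excursion B n a) = excursion (fun j => f (B j)) n a := by
  induction n generalizing a with
  | zero => cases a <;> simp [excursion]
  | succ n ih => cases a <;> simp [excursion, ih]

end Convergence

/-! ### Passage to the matrices A_{*,j}(z), and the first-return equation. -/

section Identities

variable {S : Type*}

/-- `A_{*,j}(x)` for real `x`, as a real matrix. -/
noncomputable def realAstar (A : ℤ → ℤ → Matrix S S ℝ) (x : ℝ) (j : ℤ) : Matrix S S ℝ :=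
  ∑ i ∈ ℍ, x ^ i • A i j

variable {A : ℤ → ℤ → Matrix S S ℝ}

lemma realAstar_apply (x : ℝ) (j : ℤ) (k l : S) :
    realAstar A x j k l = ∑ i ∈ ℍ, x ^ i * A i j k l := by
  simp [realAstar, Matrix.sum_apply]

lemma realAstar_nonneg (hA : ∀ i ∈ ℍ, ∀ j ∈ ℍ, ∀ k l : S, 0 ≤ A i j k l) {x : ℝ} (hx : 0 < x) :
    ∀ j ∈ ℍ, ∀ k l, 0 ≤ realAstar A x j k l := fun j hj k l => by
  rw [realAstar_apply]
  exact sum_nonneg fun i hi => mul_nonneg (zpow_pos hx i).le (hA i hi j hj k l)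

lemma realAstar_pos (hA : ∀ i ∈ ℍ, ∀ j ∈ ℍ, ∀ k l : S, 0 ≤ A i j k l) {x : ℝ} (hx : 0 < x) :
    ∀ i ∈ ℍ, ∀ j ∈ ℍ, ∀ k l, 0 < A i j k l → 0 < realAstar A x j k l := fun i hi j hj k l h => by
  rw [realAstar_apply]
  exact (mul_pos (zpow_pos hx i) h).trans_le (single_le_sum (f := fun i => x ^ i * A i j k l)
    (fun i hi => mul_nonneg (zpow_pos hx i).le (hA i hi j hj k l)) hi)

lemma realAstar_mulVec_le_of_subinvariant [Fintype S] {x : ℝ} (hx : 0 < x) {s₂ : ℝ} {u : S → ℝ}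
    (h : ((Real.log x, s₂), u) ∈ subinvariant A 1) :
    (realAstar A x (-1)).mulVec (fun l => Real.exp (u l)) +
      Real.exp s₂ • (realAstar A x 0).mulVec (fun l => Real.exp (u l)) +
      Real.exp s₂ ^ 2 • (realAstar A x 1).mulVec (fun l => Real.exp (u l)) ≤
      Real.exp s₂ • fun l => Real.exp (u l) := by
  intro j
  have hmv : ∀ k : ℤ, Real.exp s₂ * (Real.exp s₂ ^ k *
      (realAstar A x k).mulVec (fun l => Real.exp (u l)) j) = Real.exp s₂ * Real.exp (u j) *
      ∑ i ∈ ℍ, ∑ l, A i k j l * Real.exp (Real.log x * i + s₂ * k + u l - u j) := by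
    intro k
    rw [mul_assoc]
    congr 1
    rw [sum_comm, Matrix.mulVec, dotProduct, mul_sum, mul_sum]
    refine sum_congr rfl fun l _ => ?_
    rw [realAstar_apply, sum_mul, mul_sum, mul_sum]
    refine sum_congr rfl fun i _ => ?_
    rw [Real.exp_sub, Real.exp_add, Real.exp_add, Real.exp_mul, Real.exp_mul, Real.rpow_intCast,
      Real.rpow_intCast, Real.exp_log hx]
    have := (Real.exp_pos (u j)).ne'
    field_simp
  have h1 := mul_le_mul_of_nonneg_left (h j) (mul_pos (Real.exp_pos s₂) (Real.exp_pos (u j))).le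
  -- Multiplying C(x,w)h ≤ h by w = exp s₂ clears the negative power of w.
  rw [load, sum_comm, mul_sum, ← sum_congr rfl fun k _ => hmv k, sum_displacements] at h1
  have hw := (Real.exp_pos s₂).ne'
  simp only [zpow_neg_one, zpow_zero, zpow_one, one_mul, mul_inv_cancel_left₀ hw, mul_one] at h1
  simp only [Pi.add_apply, Pi.smul_apply, smul_eq_mul]
  rw [sq, mul_assoc]
  exact h1

lemma Astar_ofReal (x : ℝ) (j : ℤ) :
    Astar A j (x : ℂ) = (realAstar A x j).map (fun x : ℝ => (x : ℂ)) := by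
  ext k l
  rw [Matrix.map_apply, realAstar_apply]
  simp [Astar, Matrix.sum_apply]

lemma norm_Astar_le (hA : ∀ i ∈ ℍ, ∀ j ∈ ℍ, ∀ k l : S, 0 ≤ A i j k l) (z : ℂ) :
    ∀ j ∈ ℍ, ∀ k l, ‖Astar A j z k l‖ ≤ realAstar A ‖z‖ j k l := fun j hj k l => by
  rw [realAstar_apply, Astar, Matrix.sum_apply]
  refine (norm_sum_le _ _).trans (sum_le_sum fun i hi => le_of_eq ?_)
  simp [norm_zpow, abs_of_nonneg (hA i hi j hj k l)]

lemma C_eq_Astar (A : ℤ → ℤ → Matrix S S ℝ) (z w : ℂ) :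
    C A z w = w⁻¹ • Astar A (-1) z + Astar A 0 z + w • Astar A 1 z := by
  have h : C A z w = ∑ j ∈ ℍ, w ^ j • Astar A j z := by
    rw [C, sum_comm]
    refine sum_congr rfl fun j _ => ?_
    rw [Astar, smul_sum]
    exact sum_congr rfl fun i _ => by rw [smul_smul, mul_comm]
  rw [h]
  ext k l
  rw [Matrix.sum_apply, sum_displacements]
  simp

variable [Fintype S] [DecidableEq S]

lemma Q₁₁_ofReal (x : ℝ) (n : ℕ) :
    Q₁₁ A (x : ℂ) n = (excursion (realAstar A x) n 0).map (fun x : ℝ => (x : ℂ)) := by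
  rw [Q₁₁_eq_excursion]
  simp only [Astar_ofReal]
  exact (map_excursion (Complex.ofRealHom.mapMatrix) (realAstar A x) n 0).symm

lemma norm_Q₁₁_le (hA : ∀ i ∈ ℍ, ∀ j ∈ ℍ, ∀ k l : S, 0 ≤ A i j k l) (z : ℂ) (n : ℕ) (k l : S) :
    ‖Q₁₁ A z n k l‖ ≤ excursion (realAstar A ‖z‖) n 0 k l := by
  rw [Q₁₁_eq_excursion]
  exact norm_excursion_le (norm_Astar_le hA z) n 0 k l

lemma summable_excursion_realAstar [Nonempty S] (hA : ∀ i ∈ ℍ, ∀ j ∈ ℍ, ∀ k l : S, 0 ≤ A i j k l)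
    (hS : blockSum A ∈ Matrix.rowStochastic ℝ S)
    (hI : (transitionMatrix A).IsIrreducible) {x : ℝ} (h1 : zLow₁ A ≤ x) (h2 : x ≤ zHigh₁ A)
    (k l : S) : Summable fun n => excursion (realAstar A x) n 0 k l := by
  have hx : 0 < x := (Real.exp_pos _).trans_le h1
  obtain ⟨s₂, u, hu⟩ := exists_subinvariant_of_mem_Icc hA hS hI h1 h2
  exact summable_excursion hI (realAstar_nonneg hA hx) (realAstar_pos hA hx)
    (fun l => Real.exp_pos (u l)) (Real.exp_pos s₂) (realAstar_mulVec_le_of_subinvariant hx hu) k l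

lemma N₁_first_return {z : ℂ} (hs : ∀ k l, Summable fun n => ‖Q₁₁ A z n k l‖) :
    N₁ A z = 1 + H₁ A z * N₁ A z := by
  have hQ : Summable (Q₁₁ A z) := summable_matrix hs
  set B : ℤ → Matrix S S ℂ := fun j => Astar A j z
  have hrec : ∀ n, Q₁₁ A z (n + 1) = B 0 * Q₁₁ A z n + B 1 * excursion B n 1 := fun n => by
    simp only [Q₁₁_eq_excursion]
    rfl
  have hone : HasSum (fun n => excursion B n 1) (N₁ A z * B (-1) * N₁ A z) := by
    have hc := hasSum_antidiagonal_matrix (summable_norm_matrix_mul hs (B (-1))) hs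
    have e : ∑' n, Q₁₁ A z n * B (-1) = N₁ A z * B (-1) := hQ.tsum_mul_right _
    rw [e] at hc
    change HasSum _ (_ * N₁ A z) at hc
    have hsum : (fun n => ∑ p ∈ antidiagonal n, Q₁₁ A z p.1 * B (-1) * Q₁₁ A z p.2) =
        fun n => excursion B (n + 1) 1 := by
      funext n
      rw [excursion_succ_level B n 0]
      simp only [Q₁₁_eq_excursion]
      rfl
    rw [hsum] at hc
    -- The shift by one costs nothing: no walk of length 0 leads from level 1 to level 0.
    have := (hasSum_nat_add_iff (f := fun n => excursion B n 1) 1).1 hc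
    simpa [excursion] using this
  have hshift : HasSum (fun n => Q₁₁ A z (n + 1))
      (B 0 * N₁ A z + B 1 * (N₁ A z * B (-1) * N₁ A z)) := by
    simp only [hrec]
    exact (hQ.hasSum.mul_left _).add (hone.mul_left _)
  have h0 : N₁ A z = 1 + ∑' n, Q₁₁ A z (n + 1) := hQ.tsum_eq_zero_add
  rw [hshift.tsum_eq] at h0
  rw [H₁, add_mul]
  simpa only [mul_assoc] using h0

end Identities

end TwoDQBD

/-! ### Assembly of the theorem. -/

open TwoDQBD

open scoped ComplexOrder
/-- The inequalities between complex numbers in the first part are those of `ComplexOrder`: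
`a ≤ b` means that `a.re ≤ b.re` and `a.im = b.im`. In particular they say that the entries of
`N₁(|z|)`, `G₁(|z|)` and `R₁(|z|)` are real. -/
theorem lemma4p1 {S : Type*} [Fintype S] [DecidableEq S] [Nonempty S]
    (A : ℤ → ℤ → Matrix S S ℝ)
    (hA_nonneg : ∀ i ∈ ℍ, ∀ j ∈ ℍ, ∀ k l : S, 0 ≤ A i j k l)
    (hA_stoch : blockSum A ∈ Matrix.rowStochastic ℝ S)
    (hA_irred : (transitionMatrix A).IsIrreducible)
    (hA_aper : IsAperiodic (transitionMatrix A))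
    (z : ℂ) (hz_low : zLow₁ A ≤ ‖z‖) (hz_high : ‖z‖ ≤ zHigh₁ A) :
    -- absolute convergence, and the bounds of the moduli
    ((∀ k l : S, Summable fun n : ℕ => ‖Q₁₁ A z n k l‖) ∧
      (∀ k l : S, Summable fun n : ℕ => ‖D₁ A z (n + 1) k l‖) ∧
      (∀ k l : S, Summable fun n : ℕ => ‖U₁ A z (n + 1) k l‖) ∧
      (∀ k l : S, (‖N₁ A z k l‖ : ℂ) ≤ N₁ A (‖z‖ : ℂ) k l) ∧
      (∀ k l : S, (‖G₁ A z k l‖ : ℂ) ≤ G₁ A (‖z‖ : ℂ) k l) ∧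
      (∀ k l : S, (‖R₁ A z k l‖ : ℂ) ≤ R₁ A (‖z‖ : ℂ) k l)) ∧
    -- representation through `N₁`
    (G₁ A z = N₁ A z * Astar A (-1) z ∧ R₁ A z = Astar A 1 z * N₁ A z) ∧
    -- matrix quadratic equations
    (Astar A (-1) z + Astar A 0 z * G₁ A z + Astar A 1 z * G₁ A z ^ 2 = G₁ A z ∧
      R₁ A z ^ 2 * Astar A (-1) z + R₁ A z * Astar A 0 z + Astar A 1 z = R₁ A z) ∧
    -- relation between `H₁` and `N₁`
    ((1 - H₁ A z) * N₁ A z = 1) ∧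
    -- factorization
    (∀ w : ℂ, w ≠ 0 →
      1 - C A z w =
        (w⁻¹ • (1 : Matrix S S ℂ) - R₁ A z) * (1 - H₁ A z) *
          (w • (1 : Matrix S S ℂ) - G₁ A z)) := by
  have hE := summable_excursion_realAstar hA_nonneg hA_stoch hA_irred hz_low hz_high
  have hE0 : ∀ n k l, 0 ≤ excursion (realAstar A ‖z‖) n 0 k l := fun n =>
    excursion_nonneg (realAstar_nonneg hA_nonneg ((Real.exp_pos _).trans_le hz_low)) n 0
  -- The majorant depends only on the modulus, so ζ = z and ζ = |z| are treated together.
  have hQ : ∀ ζ : ℂ, ‖ζ‖ = ‖z‖ → ∀ k l, Summable fun n => ‖Q₁₁ A ζ n k l‖ := fun ζ hζ k l =>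
    (hE k l).of_nonneg_of_le (fun n => norm_nonneg _) fun n => hζ ▸ norm_Q₁₁_le hA_nonneg ζ n k l
  have hG : ∀ ζ : ℂ, ‖ζ‖ = ‖z‖ → G₁ A ζ = N₁ A ζ * Astar A (-1) ζ := fun ζ hζ => by
    simp only [G₁, D₁_succ]
    exact (summable_matrix (hQ ζ hζ)).tsum_mul_right _
  have hR : ∀ ζ : ℂ, ‖ζ‖ = ‖z‖ → R₁ A ζ = Astar A 1 ζ * N₁ A ζ := fun ζ hζ => by
    simp only [R₁, U₁_succ]
    exact (summable_matrix (hQ ζ hζ)).tsum_mul_left _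
  have hD : ∀ k l, Summable fun n => ‖D₁ A z (n + 1) k l‖ := by
    simp only [D₁_succ]
    exact summable_norm_matrix_mul (hQ z rfl) _
  have hU : ∀ k l, Summable fun n => ‖U₁ A z (n + 1) k l‖ := by
    simp only [U₁_succ]
    exact summable_norm_mul_matrix (hQ z rfl) _
  have hzz : ‖(‖z‖ : ℂ)‖ = ‖z‖ := by simp
  have hNle : ∀ k l, ‖N₁ A z k l‖ ≤ ∑' n, excursion (realAstar A ‖z‖) n 0 k l :=
    norm_tsum_matrix_le (norm_Q₁₁_le hA_nonneg z) hE
  have hNreal : ∀ k l, N₁ A (‖z‖ : ℂ) k l =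
      ((∑' n, excursion (realAstar A ‖z‖) n 0 k l : ℝ) : ℂ) := fun k l => by
    rw [N₁, tsum_matrix_apply (summable_matrix (hQ _ hzz))]
    simp only [Q₁₁_ofReal, Matrix.map_apply]
    exact (Complex.ofReal_tsum _).symm
  have hB := norm_Astar_le hA_nonneg z
  have hN := N₁_first_return (hQ z rfl)
  have hHN : (1 - H₁ A z) * N₁ A z = 1 := by
    rw [sub_mul, one_mul, sub_eq_iff_eq_add]
    exact hN
  -- A one-sided inverse of a finite square matrix is two-sided.
  have hNH : N₁ A z * (1 - H₁ A z) = 1 := mul_eq_one_comm.1 hHN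
  have hGz := hG z rfl
  have hRz := hR z rfl
  have hHG : H₁ A z = Astar A 0 z + Astar A 1 z * G₁ A z := by
    rw [H₁, hGz, mul_assoc]
  have hHR : H₁ A z = Astar A 0 z + R₁ A z * Astar A (-1) z := by
    rw [H₁, hRz]
  have hIG : (1 - H₁ A z) * G₁ A z = Astar A (-1) z := by
    rw [hGz, ← mul_assoc, hHN, one_mul]
  have hRI : R₁ A z * (1 - H₁ A z) = Astar A 1 z := by
    rw [hRz, mul_assoc, hNH, mul_one]
  refine ⟨⟨hQ z rfl, hD, hU, fun k l => ?_, fun k l => ?_, fun k l => ?_⟩, ⟨hGz, hRz⟩, ⟨?_, ?_⟩,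
    hHN, fun w hw => ?_⟩
  · rw [hNreal]
    exact Complex.real_le_real.2 (hNle k l)
  · rw [hG _ hzz, hGz]
    simp only [Matrix.mul_apply, hNreal, Astar_ofReal, Matrix.map_apply]
    norm_cast
    refine (norm_sum_le _ _).trans (Finset.sum_le_sum fun p _ => ?_)
    rw [norm_mul]
    exact mul_le_mul (hNle k p) (hB _ (by decide) p l) (norm_nonneg _)
      (tsum_nonneg fun n => hE0 n k p)
  · rw [hR _ hzz, hRz]
    simp only [Matrix.mul_apply, hNreal, Astar_ofReal, Matrix.map_apply]
    norm_cast
    refine (norm_sum_le _ _).trans (Finset.sum_le_sum fun p _ => ?_)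
    rw [norm_mul]
    exact mul_le_mul (hB _ (by decide) k p) (hNle p l) (norm_nonneg _)
      ((norm_nonneg _).trans (hB _ (by decide) k p))
  -- The quadratic equation for G₁ is (I − H₁)G₁ = A_{*,-1} with H₁ = A_{*,0} + A_{*,1}G₁; the one
  -- for R₁ is its mirror image.
  · rw [← hIG, hHG]
    noncomm_ring
  · rw [← hRI, hHR]
    noncomm_ring
  -- The cross term R₁(I − H₁)G₁ = A_{*,1}G₁ cancels against the same term in H₁ and leaves A_{*,0}.
  · have e : (w⁻¹ • (1 : Matrix S S ℂ) - R₁ A z) * (1 - H₁ A z) * (w • (1 : Matrix S S ℂ) - G₁ A z) =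
        (1 - H₁ A z) - w⁻¹ • Astar A (-1) z - w • Astar A 1 z + Astar A 1 z * G₁ A z := by
      rw [sub_mul, hRI, mul_sub, sub_mul, sub_mul, smul_mul_assoc, one_mul, smul_mul_assoc, smul_mul_assoc,
        hIG, mul_smul_comm, mul_one, smul_smul, inv_mul_cancel₀ hw, one_smul, mul_smul_comm, mul_one]
      abel
    rw [e, C_eq_Astar, hHG]
    abel
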